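/- Trap is a two-player game on an undirected graph: a token starts at an initial vertex, and the two players alternately move it along an edge to a vertex that the token has never visited before; a player who has no possible move loses. A position consists of the location of the token and the set of visited vertices, and a strategy assigns to each position a legal next move (where one exists). The game from a given initial vertex is a win for a player who has a strategy that results in a win no matter what strategy the other player uses, and it is a draw if neither player has such a strategy. Consider the square lattice $\mathbb{Z}^2$, with an edge between $u$ and $v$ whenever $\|u-v\|_1=1$, and call a vertex odd or even according to whether the sum of its coordinates is odd or even. For $p,q\in[0,1]$, consider the model in which the vertices are closed independently, each odd vertex with probability $p$ and each even vertex with probability $q$; vertices that are not closed are open. Trap is played on the subgraph of $\mathbb{Z}^2$ induced by the open vertices, which is known to both players; if the initial vertex is closed, the game is declared a win for the first player. There exists an absolute constant $c_0>0$ such that, for all $p\in(0,1]$ and $q\in[0,1]$ with $$q < c_0\, p^2 \bigl(\log p^{-1}\bigr)^{-2}$$ (where the right-hand side is read as $+\infty$ if $p=1$), almost surely, for every initial vertex, Trap is not a draw. -/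

import Mathlib

/-! ### The game of Trap

Trap is played on the subgraph of `G` induced by the complement of a set `C` of *closed* vertices:
the token moves along edges of `G` to open vertices that it has not visited before, and a player
who has no possible move loses. -/

namespace Trap

/-- A position of the game: the location of the token and the set of visited vertices. -/
structure Position (V : Type*) where
  /-- the location of the token -/
  token : V
  /-- the set of vertices visited so far -/
  visited : Set V

/-- The position at the start of the game, with the token at the initial vertex `v`. -/
def Position.initial {V : Type*} (v : V) : Position V := ⟨v, {v}⟩

/-- The position reached from `x` when the token is moved to `w`. -/
def Position.move {V : Type*} (x : Position V) (w : V) : Position V := ⟨w, insert w x.visited⟩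

/-- Moving the token to `w` is legal: `w` is a neighbour of the current location, it is open, and
it has not been visited. -/
def IsLegal {V : Type*} (G : SimpleGraph V) (C : Set V) (x : Position V) (w : V) : Prop :=
  G.Adj x.token w ∧ w ∉ C ∧ w ∉ x.visited

/-- The player whose turn it is has no possible move. -/
def IsStuck {V : Type*} (G : SimpleGraph V) (C : Set V) (x : Position V) : Prop :=
  ∀ w, ¬ IsLegal G C x w

/-- A strategy assigns to each position a legal next move, where one exists. (Its value at a
position without legal moves is irrelevant.) -/
structure Strategy {V : Type*} (G : SimpleGraph V) (C : Set V) where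
  /-- the vertex to move to -/
  next : Position V → V
  legal : ∀ x, ¬ IsStuck G C x → IsLegal G C x (next x)

/-- The position after `n` moves when the first player uses `σ` and the second player uses `τ`.
(From the first stuck position on, the game is over and the sequence has no meaning.) -/
def play {V : Type*} {G : SimpleGraph V} {C : Set V} (σ τ : Strategy G C) (v : V) :
    ℕ → Position V
  | 0 => Position.initial v
  | n + 1 => (play σ τ v n).move ((if Even n then σ else τ).next (play σ τ v n))

/-- The game between `σ` and `τ` ends after exactly `n` moves: the player to move is then stuck,
and this did not happen before. -/
def EndsAt {V : Type*} {G : SimpleGraph V} {C : Set V} (σ τ : Strategy G C) (v : V)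
    (n : ℕ) : Prop :=
  IsStuck G C (play σ τ v n) ∧ ∀ m < n, ¬ IsStuck G C (play σ τ v m)

/-- The game from `v` is a win for the first player: she has a strategy such that, against every
strategy of the opponent, the second player gets stuck (i.e. the game ends after an odd number of
moves). By convention the first player also wins if the initial vertex is closed. -/
def IsFirstPlayerWin {V : Type*} (G : SimpleGraph V) (C : Set V) (v : V) : Prop :=
  v ∈ C ∨ ∃ σ : Strategy G C, ∀ τ : Strategy G C, ∃ n, Odd n ∧ EndsAt σ τ v n

/-- The game from `v` is a win for the second player: the initial vertex is open and she has a
strategy such that, against every strategy of the opponent, the first player gets stuck (i.e. the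
game ends after an even number of moves). -/
def IsSecondPlayerWin {V : Type*} (G : SimpleGraph V) (C : Set V) (v : V) : Prop :=
  v ∉ C ∧ ∃ τ : Strategy G C, ∀ σ : Strategy G C, ∃ n, Even n ∧ EndsAt σ τ v n

/-- The game from `v` is a draw: neither player has a winning strategy. -/
def IsDraw {V : Type*} (G : SimpleGraph V) (C : Set V) (v : V) : Prop :=
  ¬ IsFirstPlayerWin G C v ∧ ¬ IsSecondPlayerWin G C v

end Trap

/-! ### Percolation on the square lattice -/

/-- The square lattice: `u` and `v` are adjacent when their `ℓ¹` distance is `1`. -/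
def squareLattice : SimpleGraph (ℤ × ℤ) where
  Adj u v := |u.1 - v.1| + |u.2 - v.2| = 1
  symm := ⟨fun u v h => by simpa only [abs_sub_comm] using h⟩
  loopless := ⟨fun u h => by simp at h⟩

/-- A vertex of the square lattice is odd when the sum of its coordinates is odd, and even
otherwise. -/
def IsOddVertex (u : ℤ × ℤ) : Prop := Odd (u.1 + u.2)

open Classical in
/-- The law of the random configuration `ω : ℤ × ℤ → Prop`, where `ω u` means that `u` is closed:
the vertices are independent, and each odd (resp. even) vertex is closed with probability `p`
(resp. `q`). -/
noncomputable def closedLaw (p q : unitInterval) : MeasureTheory.Measure (ℤ × ℤ → Prop) :=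
  MeasureTheory.Measure.infinitePi fun u =>
    ProbabilityTheory.bernoulliMeasure True False (if IsOddVertex u then p else q)

/-! ### Winning and losing positions with a bounded number of moves -/

namespace Trap

/-! Suppose a finite set T of open even vertices contains the token's location w, and the open
neighbours of T are matched injectively into T minus w. Then the player not to move wins by always
replying along the matching: after the moves u and f u, rematching u to w leaves f u unmatched
(`IsCertificate.flip`), and T is finite. Call such w safe. As long as no safe vertex has been
visited, a player standing next to a safe vertex wins by stepping onto it. A draw therefore needs an
infinite cluster of open vertices neither safe nor adjacent to a safe one (`not_isDraw_of_finite`).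

Safe vertices are abundant because of pinwheels. The pinwheel of size m is a tilted square of
(2m-1)^2 even vertices. Its 4m^2 odd neighbours split into 4m diagonal arrays of m vertices, and
each array is strung together by m-1 even links; the 4m(m-1) links are all the even vertices except
the centre. If all its even vertices are open and every array has a closed vertex, the remaining odd
vertices can be matched to links (`mem_safeSet_of_pinwheel`).

An array is entirely open with probability (1-p)^m. With m of order log(1/p)/p this beats the number
of arrays near a block of side 2m, while a closed even vertex nearby costs a probability of order
m^2 q, which the hypothesis makes small. Badness of a block depends only on the surrounding 3 × 3
blocks, so a Peierls count over paths of bad blocks (`closedLaw_exists_isBadPath_le`) rules out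
infinite unsafe clusters. -/

/-- The player to move from the position `x` can force a win in which she makes at most `n`
moves. -/
def WinsWithin {V : Type*} (G : SimpleGraph V) (C : Set V) : ℕ → Position V → Prop
  | 0, _ => False
  | n + 1, x => ∃ w, IsLegal G C x w ∧
      ∀ w', IsLegal G C (x.move w) w' → WinsWithin G C n ((x.move w).move w')

/-- The player to move from the position `x` can force a win in a bounded number of moves. -/
def Winning {V : Type*} (G : SimpleGraph V) (C : Set V) (x : Position V) : Prop :=
  ∃ n, WinsWithin G C n x

/-- The player who is not to move from the position `x` can force a win. -/
def Losing {V : Type*} (G : SimpleGraph V) (C : Set V) (x : Position V) : Prop :=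
  ∀ w, IsLegal G C x w → Winning G C (x.move w)

section Game

variable {V : Type*} {G : SimpleGraph V} {C : Set V}

theorem WinsWithin.succ {n : ℕ} {x : Position V} (h : WinsWithin G C n x) :
    WinsWithin G C (n + 1) x := by
  induction n generalizing x with
  | zero => exact h.elim
  | succ n ih =>
    obtain ⟨w, hw, h⟩ := h
    exact ⟨w, hw, fun w' hw' => ih (h w' hw')⟩

theorem WinsWithin.mono {m n : ℕ} (hmn : m ≤ n) {x : Position V} (h : WinsWithin G C m x) :
    WinsWithin G C n x := by
  induction hmn with
  | refl => exact h
  | step _ ih => exact ih.succ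

/-- Local finiteness lets the bounds for the finitely many replies be replaced by their maximum. -/
theorem Losing.winning (hG : ∀ v, (G.neighborSet v).Finite) {x : Position V} {w : V}
    (hw : IsLegal G C x w) (h : Losing G C (x.move w)) : Winning G C x := by
  have hfin : {w' | IsLegal G C (x.move w) w'}.Finite := (hG w).subset fun w' hw' => hw'.1
  choose! f hf using h
  obtain ⟨N, hN⟩ := (hfin.image f).bddAbove
  exact ⟨N + 1, w, hw, fun w' hw' => (hf w' hw').mono (hN ⟨w', hw', rfl⟩)⟩

theorem winning_or_losing_of_moves (hG : ∀ v, (G.neighborSet v).Finite) {x : Position V}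
    (h : ∀ w, IsLegal G C x w → Winning G C (x.move w) ∨ Losing G C (x.move w)) :
    Winning G C x ∨ Losing G C x := by
  by_cases h' : ∃ w, IsLegal G C x w ∧ Losing G C (x.move w)
  · obtain ⟨w, hw, h'⟩ := h'
    exact Or.inl (h'.winning hG hw)
  · push Not at h'
    exact Or.inr fun w hw => (h w hw).resolve_right (h' w hw)

-- A good move lowers the least bound in each round, so following such moves cannot postpone the win
-- forever.
open Classical in
theorem Winning.exists_move {x : Position V} (h : Winning G C x) :
    ∃ w, IsLegal G C x w ∧ ∀ w', IsLegal G C (x.move w) w' →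
      ∃ m < Nat.find h, WinsWithin G C m ((x.move w).move w') := by
  have h' := Nat.find_spec h
  cases hn : Nat.find h with
  | zero => rw [hn] at h'; exact h'.elim
  | succ n =>
    rw [hn] at h'
    obtain ⟨w, hw, h'⟩ := h'
    exact ⟨w, hw, fun w' hw' => ⟨n, n.lt_succ_self, h' w' hw'⟩⟩

variable (G C) in
open Classical in
/-- The strategy that forces the quickest win whenever there is one. -/
noncomputable def optimalStrategy : Strategy G C where
  next x :=
    if h : Winning G C x then h.exists_move.choose
    else if h : ∃ w, IsLegal G C x w then h.choose else x.token
  legal x hx := by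
    by_cases h : Winning G C x
    · rw [dif_pos h]
      exact h.exists_move.choose_spec.1
    · have h' : ∃ w, IsLegal G C x w := by simpa [IsStuck] using hx
      rw [dif_neg h, dif_pos h']
      exact h'.choose_spec

open Classical in
theorem Winning.optimalStrategy_spec {x : Position V} (h : Winning G C x) (w' : V)
    (hw' : IsLegal G C (x.move ((optimalStrategy G C).next x)) w') :
    ∃ m < Nat.find h,
      WinsWithin G C m ((x.move ((optimalStrategy G C).next x)).move w') := by
  have := h.exists_move.choose_spec.2 w'
  simp only [optimalStrategy, dif_pos h] at hw' ⊢
  exact this hw'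

theorem Winning.not_isStuck {x : Position V} (h : Winning G C x) : ¬ IsStuck G C x := by
  classical
  obtain ⟨w, hw, -⟩ := h.exists_move
  exact fun hs => hs w hw

/-- From a winning position the player to move wins by following the optimal strategy. -/
theorem exists_endsAt_of_winning {σ τ : Strategy G C} {v : V} {n : ℕ}
    (hσ : (if Even n then σ else τ) = optimalStrategy G C)
    (hn : ∀ m < n, ¬ IsStuck G C (play σ τ v m)) (h : Winning G C (play σ τ v n)) :
    ∃ k, Odd k ∧ EndsAt σ τ v (n + k) := by
  classical
  induction hN : Nat.find h using Nat.strong_induction_on generalizing n with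
  | _ N ih =>
    have hn' : ∀ m < n + 1, ¬ IsStuck G C (play σ τ v m) := fun m hm => by
      rcases Nat.lt_succ_iff_lt_or_eq.1 hm with hm | rfl
      exacts [hn m hm, h.not_isStuck]
    by_cases hs : IsStuck G C (play σ τ v (n + 1))
    · exact ⟨1, odd_one, hs, hn'⟩
    have hplay : play σ τ v (n + 1) =
        (play σ τ v n).move ((optimalStrategy G C).next (play σ τ v n)) := by
      rw [play, hσ]
    have hleg := ((if Even (n + 1) then σ else τ) : Strategy G C).legal _ hs
    set w' := ((if Even (n + 1) then σ else τ) : Strategy G C).next (play σ τ v (n + 1)) with hw'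
    have hplay2 : play σ τ v (n + 2) = (play σ τ v (n + 1)).move w' := rfl
    rw [hplay] at hleg hplay2
    obtain ⟨m, hm, hwin⟩ := h.optimalStrategy_spec w' hleg
    rw [← hplay2] at hwin
    have hwin' : Winning G C (play σ τ v (n + 2)) := ⟨m, hwin⟩
    obtain ⟨k, hk, hend⟩ := ih (Nat.find hwin') (hN ▸ (Nat.find_min' hwin' hwin).trans_lt hm)
      (n := n + 2) (by simpa [Nat.even_add] using hσ) (fun m hm => by
        rcases Nat.lt_succ_iff_lt_or_eq.1 hm with hm | rfl
        exacts [hn' m hm, hs]) hwin' rfl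
    exact ⟨2 + k, even_two.add_odd hk, by rwa [← add_assoc]⟩

theorem isFirstPlayerWin_of_winning {v : V} (h : Winning G C (Position.initial v)) :
    IsFirstPlayerWin G C v := by
  refine Or.inr ⟨optimalStrategy G C, fun τ => ?_⟩
  obtain ⟨k, hk, hend⟩ := exists_endsAt_of_winning (σ := optimalStrategy G C) (τ := τ) (v := v)
    (n := 0) (by simp) (by simp) h
  exact ⟨k, hk, by simpa using hend⟩

theorem isSecondPlayerWin_of_losing {v : V} (hv : v ∉ C)
    (h : Losing G C (Position.initial v)) : IsSecondPlayerWin G C v := by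
  refine ⟨hv, optimalStrategy G C, fun σ => ?_⟩
  by_cases hs : IsStuck G C (Position.initial v)
  · exact ⟨0, by simp, hs, by simp⟩
  obtain ⟨k, hk, hend⟩ := exists_endsAt_of_winning (σ := σ) (τ := optimalStrategy G C) (v := v)
    (n := 1) (by simp) (fun m hm => by rwa [Nat.lt_one_iff.1 hm]) (h _ (σ.legal _ hs))
  exact ⟨1 + k, odd_one.add_odd hk, hend⟩

theorem not_isDraw_of_winning_or_losing {v : V}
    (h : v ∈ C ∨ Winning G C (Position.initial v) ∨ Losing G C (Position.initial v)) :
    ¬ IsDraw G C v := by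
  rintro ⟨h1, h2⟩
  have hv : v ∉ C := fun hv => h1 (Or.inl hv)
  rcases h with h | h | h
  exacts [hv h, h1 (isFirstPlayerWin_of_winning h), h2 (isSecondPlayerWin_of_losing hv h)]

/-! ### Certificates for a win of the player who is not to move -/

/-- `f` matches the open neighbours of the finite set `T` of open vertices into `T`, and
leaves `w ∈ T` unmatched. -/
structure IsCertificate (G : SimpleGraph V) (C : Set V) (T : Set V) (f : V → V) (w : V) :
    Prop where
  finite : T.Finite
  disjoint : ∀ t ∈ T, t ∉ C
  mem : w ∈ T
  map_mem : ∀ t ∈ T, ∀ u ∉ C, G.Adj t u → f u ∈ T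
  adj : ∀ t ∈ T, ∀ u ∉ C, G.Adj t u → G.Adj u (f u)
  ne : ∀ t ∈ T, ∀ u ∉ C, G.Adj t u → f u ≠ w
  inj : ∀ t ∈ T, ∀ u ∉ C, G.Adj t u → ∀ t' ∈ T, ∀ u' ∉ C, G.Adj t' u' → f u = f u' → u = u'

/-- The vertices of the colour class `c` at which some certificate in this class shows that the
player to move loses. -/
def safeSet (G : SimpleGraph V) (C : Set V) (c : Set V) : Set V :=
  {w | ∃ T ⊆ c, ∃ f, IsCertificate G C T f w}

/-- The open neighbours of the safe set. -/
def safeNeighbors (G : SimpleGraph V) (C : Set V) (c : Set V) : Set V :=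
  {u | u ∉ C ∧ ∃ w ∈ safeSet G C c, G.Adj w u}

-- After the moves u and f u, the old location w is free to serve as the partner of u, and f u
-- becomes the unmatched vertex.
open Classical in
theorem IsCertificate.flip {T : Set V} {f : V → V} {w u : V} (h : IsCertificate G C T f w)
    (hu : u ∉ C) (hwu : G.Adj w u) :
    IsCertificate G C T (Function.update f u w) (f u) where
  finite := h.finite
  disjoint := h.disjoint
  mem := h.map_mem w h.mem u hu hwu
  map_mem t ht u' hu' ha := by
    by_cases e : u' = u
    · subst e; simpa using h.mem
    · simpa [e] using h.map_mem t ht u' hu' ha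
  adj t ht u' hu' ha := by
    by_cases e : u' = u
    · subst e; simpa using hwu.symm
    · simpa [e] using h.adj t ht u' hu' ha
  ne t ht u' hu' ha := by
    by_cases e : u' = u
    · subst e; simpa using (h.ne w h.mem u' hu hwu).symm
    · simpa [e] using fun e' => e (h.inj t ht u' hu' ha w h.mem u hu hwu e')
  inj t ht u' hu' ha t' ht' u'' hu'' ha' hf := by
    by_cases e : u' = u <;> by_cases e' : u'' = u
    · rw [e, e']
    · subst e; simp only [Function.update_self, Function.update_of_ne e'] at hf
      exact absurd hf.symm (h.ne t' ht' u'' hu'' ha')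
    · subst e'; simp only [Function.update_self, Function.update_of_ne e] at hf
      exact absurd hf (h.ne t ht u' hu' ha)
    · simp only [Function.update_of_ne e', Function.update_of_ne e] at hf
      exact h.inj t ht u' hu' ha t' ht' u'' hu'' ha' hf

theorem IsCertificate.map_mem_safeSet {c T : Set V} {f : V → V} {w u : V} (hT : T ⊆ c)
    (h : IsCertificate G C T f w) (hu : u ∉ C) (hwu : G.Adj w u) : f u ∈ safeSet G C c := by
  classical
  exact ⟨T, hT, _, h.flip hu hwu⟩

/-- The certificate holder wins even if some vertices that are not safe have been visited. -/
theorem IsCertificate.losing {c T : Set V} (hG : ∀ v, (G.neighborSet v).Finite)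
    (hc : ∀ a b, G.Adj a b → (a ∈ c ↔ b ∉ c)) (hT : T ⊆ c) {f : V → V} {x : Position V}
    (h : IsCertificate G C T f x.token)
    (hx : ∀ s ∈ x.visited, s ∈ safeSet G C c → s = x.token ∨
      ∃ t ∈ T, ∃ u ∉ C, G.Adj t u ∧ u ∈ x.visited ∧ f u = s) : Losing G C x := by
  classical
  have hsafe : safeSet G C c ⊆ c := fun w ⟨T, hT, f, h⟩ => hT h.mem
  induction hN : (T \ x.visited).ncard using Nat.strong_induction_on generalizing x f with
  | _ N ih =>
  rintro u ⟨hadj, huC, huv⟩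
  have hfu := h.map_mem_safeSet hT huC hadj
  have huc : u ∉ c := (hc _ _ hadj).1 (hT h.mem)
  have hadj' := h.adj _ h.mem u huC hadj
  have hfuT := h.map_mem _ h.mem u huC hadj
  -- Invariant `hx`: visited safe vertices other than the token are partners of visited neighbours.
  -- As u is unvisited, injectivity keeps its partner unvisited.
  have hnv : f u ∉ x.visited := fun hv => by
    rcases hx _ hv hfu with e | ⟨t, ht, u', hu', ha, hv', e⟩
    · exact h.ne _ h.mem u huC hadj e
    · exact huv (h.inj t ht u' hu' ha _ h.mem u huC hadj e ▸ hv')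
  have hnu : f u ≠ u := fun e => hadj'.ne e.symm
  refine Losing.winning hG (w := f u) ⟨hadj', h.disjoint _ hfuT, ?_⟩ ?_
  · simpa [Position.move, hnu] using hnv
  refine ih _ ?_ (x := (x.move u).move (f u)) (f := Function.update f u x.token)
    (h.flip huC hadj) ?_ rfl
  -- The reply uses up a new vertex of T, so the induction descends.
  · rw [← hN]
    refine Set.ncard_lt_ncard (Set.ssubset_iff_of_subset ?_ |>.2
      ⟨f u, ⟨hfuT, hnv⟩, by simp [Position.move]⟩) (h.finite.sdiff)
    exact Set.sdiff_subset_sdiff_right fun a ha => by simp [Position.move, ha]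
  · intro s hs hss
    simp only [Position.move, Set.mem_insert_iff] at hs ⊢
    rcases hs with rfl | rfl | hs
    · exact Or.inl rfl
    · exact absurd (hsafe hss) huc
    · refine Or.inr ?_
      rcases hx s hs hss with rfl | ⟨t, ht, u', hu', ha, hv', rfl⟩
      · exact ⟨_, h.mem, u, huC, hadj, by simp⟩
      · have : u' ≠ u := fun e => huv (e ▸ hv')
        exact ⟨t, ht, u', hu', ha, by simp [hv'], by simp [this]⟩

theorem losing_of_mem_safeSet {c : Set V} (hG : ∀ v, (G.neighborSet v).Finite)
    (hc : ∀ a b, G.Adj a b → (a ∈ c ↔ b ∉ c)) {x : Position V}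
    (hx : x.token ∈ safeSet G C c) (hv : ∀ s ∈ x.visited, s ∈ safeSet G C c → s = x.token) :
    Losing G C x := by
  obtain ⟨T, hT, f, h⟩ := hx
  exact h.losing hG hc hT fun s hs hss => Or.inl (hv s hs hss)

theorem winning_of_mem_safeNeighbors {c : Set V} (hG : ∀ v, (G.neighborSet v).Finite)
    (hc : ∀ a b, G.Adj a b → (a ∈ c ↔ b ∉ c)) {x : Position V}
    (hx : x.token ∈ safeNeighbors G C c) (hv : Disjoint x.visited (safeSet G C c)) :
    Winning G C x := by
  obtain ⟨hC, w, hw, hadj⟩ := hx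
  have hwv : w ∉ x.visited := fun h => Set.disjoint_left.1 hv h hw
  refine Losing.winning hG (w := w) ⟨hadj.symm, ?_, hwv⟩
    (losing_of_mem_safeSet hG hc hw fun s hs hss => ?_)
  · obtain ⟨T, -, f, h⟩ := hw
    exact h.disjoint w h.mem
  · rcases hs with rfl | hs
    · rfl
    · exact absurd hss (Set.disjoint_left.1 hv hs)

/-! ### Finite unsafe clusters exclude draws -/

/-- The open vertices that are neither safe nor adjacent to safe vertices. -/
def unsafeSet (G : SimpleGraph V) (C : Set V) (c : Set V) : Set V :=
  {v | v ∉ C ∧ v ∉ safeSet G C c ∧ v ∉ safeNeighbors G C c}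

/-- Backward induction on the unvisited part of F. No unsafe vertex is adjacent to a safe one, so a
move leaving F can only reach a neighbour of a safe vertex, where the opponent wins. -/
theorem winning_or_losing_of_finite {c F : Set V} (hG : ∀ v, (G.neighborSet v).Finite)
    (hc : ∀ a b, G.Adj a b → (a ∈ c ↔ b ∉ c)) (hF : F.Finite) (hFu : F ⊆ unsafeSet G C c)
    (hcl : ∀ a ∈ F, ∀ b ∈ unsafeSet G C c, G.Adj a b → b ∈ F) {x : Position V}
    (hx : x.token ∈ F) (hv : x.visited ⊆ F) : Winning G C x ∨ Losing G C x := by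
  have hsafe : safeSet G C c ⊆ c := fun w ⟨T, hT, f, h⟩ => hT h.mem
  induction hN : (F \ x.visited).ncard using Nat.strong_induction_on generalizing x with
  | _ N ih =>
  refine winning_or_losing_of_moves hG fun y ⟨hadj, hyC, hyv⟩ => ?_
  by_cases hys : y ∈ safeSet G C c
  · exact absurd ⟨(hFu hx).1, y, hys, hadj.symm⟩ (hFu hx).2.2
  by_cases hyn : y ∈ safeNeighbors G C c
  · refine Or.inl (winning_of_mem_safeNeighbors hG hc hyn (Set.disjoint_left.2 ?_))
    rintro s (rfl | hs) hss
    · exact hys hss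
    · exact (hFu (hv hs)).2.1 hss
  have hyF : y ∈ F := hcl _ hx y ⟨hyC, hys, hyn⟩ hadj
  refine ih _ ?_ (x := x.move y) hyF (Set.insert_subset hyF hv) rfl
  rw [← hN]
  refine Set.ncard_lt_ncard (Set.ssubset_iff_of_subset ?_ |>.2
    ⟨y, ⟨hyF, hyv⟩, by simp [Position.move]⟩) (hF.sdiff)
  exact Set.sdiff_subset_sdiff_right fun a ha => by simp [Position.move, ha]

/-- The graph induced by the unsafe vertices. -/
def unsafeGraph (G : SimpleGraph V) (C : Set V) (c : Set V) : SimpleGraph V where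
  Adj a b := G.Adj a b ∧ a ∈ unsafeSet G C c ∧ b ∈ unsafeSet G C c
  symm := ⟨fun _ _ h => ⟨h.1.symm, h.2.2, h.2.1⟩⟩
  loopless := ⟨fun a h => G.loopless.irrefl a h.1⟩

/-- There are no draws when the unsafe vertices form finite clusters only. -/
theorem not_isDraw_of_finite {c : Set V} (hG : ∀ v, (G.neighborSet v).Finite)
    (hc : ∀ a b, G.Adj a b → (a ∈ c ↔ b ∉ c))
    (hfin : ∀ v, {a | (unsafeGraph G C c).Reachable v a}.Finite) (v : V) :
    ¬ IsDraw G C v := by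
  refine not_isDraw_of_winning_or_losing ?_
  by_cases hvC : v ∈ C
  · exact Or.inl hvC
  by_cases hvs : v ∈ safeSet G C c
  · exact Or.inr (Or.inr (losing_of_mem_safeSet hG hc hvs fun s hs _ => hs))
  by_cases hvn : v ∈ safeNeighbors G C c
  · refine Or.inr (Or.inl (winning_of_mem_safeNeighbors hG hc hvn ?_))
    simpa [Position.initial] using hvs
  refine Or.inr (winning_or_losing_of_finite (F := {a | (unsafeGraph G C c).Reachable v a}) hG hc
    (hfin v) ?_ ?_ (SimpleGraph.Reachable.refl v) ?_)
  · rintro a ⟨p⟩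
    induction p with
    | nil => exact ⟨hvC, hvs, hvn⟩
    | cons h _ ih => exact ih h.2.2.1 h.2.2.2.1 h.2.2.2.2
  · intro a ha b hb hab
    have : a ∈ unsafeSet G C c := by
      obtain ⟨p⟩ := ha
      induction p with
      | nil => exact ⟨hvC, hvs, hvn⟩
      | cons h _ ih => exact ih h.2.2.1 h.2.2.2.1 h.2.2.2.2 hab
    exact ha.trans (SimpleGraph.Adj.reachable ⟨hab, this, hb⟩)
  · rintro a rfl
    exact SimpleGraph.Reachable.refl _

end Game
end Trap

/-! ### Pinwheels in the square lattice -/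

namespace Trap

/-- The even vertices of the square lattice. -/
def evenVertices : Set (ℤ × ℤ) := {u | ¬ IsOddVertex u}

theorem squareLattice_adj_iff {u v : ℤ × ℤ} :
    squareLattice.Adj u v ↔ v = (u.1 + 1, u.2) ∨ v = (u.1 - 1, u.2) ∨ v = (u.1, u.2 + 1) ∨
      v = (u.1, u.2 - 1) := by
  obtain ⟨a, b⟩ := u
  obtain ⟨c, d⟩ := v
  simp only [squareLattice, Prod.mk.injEq]
  rcases abs_cases (a - c) with h | h <;> rcases abs_cases (b - d) with h' | h' <;> omega

theorem finite_neighborSet_squareLattice (v : ℤ × ℤ) : (squareLattice.neighborSet v).Finite := by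
  refine (Set.toFinite ({(v.1 + 1, v.2), (v.1 - 1, v.2), (v.1, v.2 + 1), (v.1, v.2 - 1)} :
    Set (ℤ × ℤ))).subset fun u hu => ?_
  simpa using squareLattice_adj_iff.1 hu

theorem mem_evenVertices_iff_of_adj (a b : ℤ × ℤ) (h : squareLattice.Adj a b) :
    a ∈ evenVertices ↔ b ∉ evenVertices := by
  rw [squareLattice_adj_iff] at h
  simp only [evenVertices, IsOddVertex, Set.mem_ofPred_eq, Int.odd_iff]
  rcases h with rfl | rfl | rfl | rfl <;> simp only <;> omega

/-- The pinwheel around `w` has four arms, each made of parallel diagonal arrays of odd vertices;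
this is the `t`-th vertex of the `r`-th array of the arm `s`. -/
def armVertex (w : ℤ × ℤ) : Fin 4 → ℕ → ℕ → ℤ × ℤ
  | 0, r, t => (w.1 - t - r - 1, w.2 - t + r)
  | 1, r, t => (w.1 - r + t, w.2 - r - 1 - t)
  | 2, r, t => (w.1 + t + r + 1, w.2 + t - r)
  | 3, r, t => (w.1 + r - t, w.2 + 1 + r + t)

/-- The even vertex used to link the `t`-th and the `t + 1`-st vertex of an array. -/
def armLink (w : ℤ × ℤ) : Fin 4 → ℕ → ℕ → ℤ × ℤ
  | 0, r, t => (w.1 - t - 1 - r, w.2 - t - 1 + r)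
  | 1, r, t => (w.1 - r + 1 + t, w.2 - r - 1 - t)
  | 2, r, t => (w.1 + 1 + t + r, w.2 + 1 + t - r)
  | 3, r, t => (w.1 + r - t - 1, w.2 + r + t + 1)

/-- The even vertices of the pinwheel of size `m` around `w`. -/
def pinwheel (w : ℤ × ℤ) (m : ℕ) : Set (ℤ × ℤ) :=
  {x | ∃ a b : ℤ, |a| < m ∧ |b| < m ∧ x = (w.1 + a + b, w.2 + a - b)}

theorem finite_pinwheel (w : ℤ × ℤ) (m : ℕ) : (pinwheel w m).Finite := by
  refine (((Set.finite_Ioo (-m : ℤ) m).prod (Set.finite_Ioo (-m : ℤ) m)).image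
    fun z => (w.1 + z.1 + z.2, w.2 + z.1 - z.2)).subset ?_
  rintro x ⟨a, b, ha, hb, rfl⟩
  exact ⟨(a, b), ⟨abs_lt.1 ha, abs_lt.1 hb⟩, rfl⟩

theorem pinwheel_subset_evenVertices {w : ℤ × ℤ} (hw : w ∈ evenVertices) (m : ℕ) :
    pinwheel w m ⊆ evenVertices := by
  rintro x ⟨a, b, -, -, rfl⟩
  simp only [evenVertices, IsOddVertex, Set.mem_ofPred_eq, Int.odd_iff] at hw ⊢
  omega

/-- In the rotated coordinates c, d the odd neighbours lie in a 2m × 2m square; the signs of c and d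
select the arm. -/
theorem exists_eq_armVertex {w x u : ℤ × ℤ} {m : ℕ} (hx : x ∈ pinwheel w m)
    (h : squareLattice.Adj x u) :
    ∃ s, ∃ r < m, ∃ t < m, u = armVertex w s r t := by
  obtain ⟨a, b, ha, hb, rfl⟩ := hx
  obtain ⟨w1, w2⟩ := w
  rw [abs_lt] at ha hb
  obtain ⟨c, d, hc, hc', hd, hd', rfl⟩ : ∃ c d : ℤ, -m < c ∧ c ≤ m ∧ -m < d ∧ d ≤ m ∧
      u = (w1 + c + d - 1, w2 + c - d) := by
    rw [squareLattice_adj_iff] at h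
    rcases h with rfl | rfl | rfl | rfl
    · exact ⟨a + 1, b + 1, by omega, by omega, by omega, by omega, by ext <;> simp <;> ring⟩
    · exact ⟨a, b, by omega, by omega, by omega, by omega, by ext <;> simp⟩
    · exact ⟨a + 1, b, by omega, by omega, by omega, by omega, by ext <;> simp <;> ring⟩
    · exact ⟨a, b + 1, by omega, by omega, by omega, by omega, by ext <;> simp <;> ring⟩
  rcases le_or_gt c 0 with h1 | h1 <;> rcases le_or_gt d 0 with h2 | h2
  · refine ⟨0, (-d).toNat, by omega, (-c).toNat, by omega, ?_⟩
    simp only [armVertex, Prod.mk.injEq]; omega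
  · refine ⟨1, (-c).toNat, by omega, (d - 1).toNat, by omega, ?_⟩
    simp only [armVertex, Prod.mk.injEq]; omega
  · refine ⟨3, (c - 1).toNat, by omega, (-d).toNat, by omega, ?_⟩
    simp only [armVertex, Prod.mk.injEq]; omega
  · refine ⟨2, (d - 1).toNat, by omega, (c - 1).toNat, by omega, ?_⟩
    simp only [armVertex, Prod.mk.injEq]; omega

theorem armLink_mem_pinwheel (w : ℤ × ℤ) {m : ℕ} (s : Fin 4) {r t : ℕ} (hr : r < m)
    (ht : t + 1 < m) : armLink w s r t ∈ pinwheel w m := by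
  simp only [pinwheel, abs_lt, Set.mem_ofPred_eq]
  fin_cases s
  · exact ⟨-(t + 1), -r, by omega, by omega, by simp only [armLink, Prod.mk.injEq]; omega⟩
  · exact ⟨-r, t + 1, by omega, by omega, by simp only [armLink, Prod.mk.injEq]; omega⟩
  · exact ⟨t + 1, r, by omega, by omega, by simp only [armLink, Prod.mk.injEq]; omega⟩
  · exact ⟨r, -(t + 1), by omega, by omega, by simp only [armLink, Prod.mk.injEq]; omega⟩

theorem armLink_ne (w : ℤ × ℤ) (s : Fin 4) (r t : ℕ) : armLink w s r t ≠ w := by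
  intro h
  rw [Prod.ext_iff] at h
  fin_cases s <;> simp only [armLink] at h <;> omega

/-- Links of different arrays never collide, so the arrays can be matched independently of each
other. -/
theorem armLink_inj {w : ℤ × ℤ} {s s' : Fin 4} {r r' t t' : ℕ}
    (h : armLink w s r t = armLink w s' r' t') : s = s' ∧ r = r' ∧ t = t' := by
  fin_cases s <;> fin_cases s' <;> simp only [armLink, Prod.mk.injEq] at h <;>
    first | (exfalso; omega) | (refine ⟨rfl, ?_, ?_⟩ <;> omega)

theorem armVertex_adj_armLink (w : ℤ × ℤ) (s : Fin 4) (r t : ℕ) :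
    squareLattice.Adj (armVertex w s r t) (armLink w s r t) := by
  rw [squareLattice_adj_iff]
  fin_cases s <;> simp only [armLink, armVertex, Prod.mk.injEq, and_true, true_and] <;> omega

theorem armVertex_succ_adj_armLink (w : ℤ × ℤ) (s : Fin 4) (r t : ℕ) :
    squareLattice.Adj (armVertex w s r (t + 1)) (armLink w s r t) := by
  rw [squareLattice_adj_iff]
  fin_cases s <;> simp only [armLink, armVertex, Prod.mk.injEq] <;> omega

theorem armVertex_inj {w : ℤ × ℤ} {s : Fin 4} {r r' t t' : ℕ}
    (h : armVertex w s r t = armVertex w s r' t') : r = r' ∧ t = t' := by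
  fin_cases s <;> simp only [armVertex, Prod.mk.injEq] at h <;> omega

theorem isOddVertex_armVertex {w : ℤ × ℤ} (hw : ¬ IsOddVertex w) (s : Fin 4) (r t : ℕ) :
    IsOddVertex (armVertex w s r t) := by
  simp only [IsOddVertex, Int.odd_iff] at hw ⊢
  fin_cases s <;> simp only [armVertex] <;> omega

theorem abs_armVertex_sub_le (w : ℤ × ℤ) (s : Fin 4) {m r t : ℕ} (hr : r < m) (ht : t < m) :
    |(armVertex w s r t).1 - w.1| < 2 * m ∧ |(armVertex w s r t).2 - w.2| < 2 * m := by
  simp only [abs_lt]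
  fin_cases s <;> simp only [armVertex] <;> omega

theorem abs_sub_lt_of_mem_pinwheel {w x : ℤ × ℤ} {m : ℕ} (hx : x ∈ pinwheel w m) :
    |x.1 - w.1| < 2 * m ∧ |x.2 - w.2| < 2 * m := by
  obtain ⟨a, b, ha, hb, rfl⟩ := hx
  simp only [abs_lt] at *
  omega

theorem pinwheel_one (w : ℤ × ℤ) : pinwheel w 1 = {w} := by
  ext x
  constructor
  · rintro ⟨a, b, ha, hb, rfl⟩
    obtain rfl : a = 0 := by rw [abs_lt] at ha; omega
    obtain rfl : b = 0 := by rw [abs_lt] at hb; omega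
    simp
  · rintro rfl
    exact ⟨0, 0, by simp⟩

/-- An even vertex is safe if its pinwheel has no closed even vertex and a closed odd vertex
in every array. -/
theorem mem_safeSet_of_pinwheel {C : Set (ℤ × ℤ)} {w : ℤ × ℤ} {m : ℕ} (hm : m ≠ 0)
    (hw : w ∈ evenVertices) (hC : ∀ x ∈ pinwheel w m, x ∉ C)
    (harm : ∀ s, ∀ r < m, ∃ t < m, armVertex w s r t ∈ C) :
    w ∈ safeSet squareLattice C evenVertices := by
  choose! k hk hkC using harm
  choose! s r hr t ht hu using
    fun u (h : ∃ x ∈ pinwheel w m, squareLattice.Adj x u) => exists_eq_armVertex h.choose_spec.1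
      h.choose_spec.2
  have hne : ∀ u, (∃ x ∈ pinwheel w m, squareLattice.Adj x u) → u ∉ C →
      t u ≠ k (s u) (r u) := fun u h huC e => huC (by
    rw [hu u h, e]; exact hkC _ _ (hr u h))
  -- Odd vertices before the closed one take the link after them, those beyond it the link before
  -- them.
  let d : ℤ × ℤ → ℕ := fun u => if t u < k (s u) (r u) then t u else t u - 1
  refine ⟨pinwheel w m, pinwheel_subset_evenVertices hw m,
    fun u => armLink w (s u) (r u) (d u), finite_pinwheel w m, hC,
    ⟨0, 0, by simpa using Nat.pos_of_ne_zero hm, by simpa using Nat.pos_of_ne_zero hm, by simp⟩,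
    ?_, ?_, ?_, ?_⟩
  · intro x hx u huC ha
    have h : ∃ x ∈ pinwheel w m, squareLattice.Adj x u := ⟨x, hx, ha⟩
    refine armLink_mem_pinwheel w _ (hr u h) ?_
    have h1 := hne u h huC
    have h2 := ht u h
    have h3 := hk (s u) _ (hr u h)
    simp only [d]
    split_ifs <;> omega
  · intro x hx u huC ha
    have h : ∃ x ∈ pinwheel w m, squareLattice.Adj x u := ⟨x, hx, ha⟩
    have h1 := hne u h huC
    conv_lhs => rw [hu u h]
    simp only [d]
    split_ifs with h4
    · exact armVertex_adj_armLink ..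
    · obtain ⟨n, hn⟩ : ∃ n, t u = n + 1 := ⟨t u - 1, by omega⟩
      rw [hn]
      exact armVertex_succ_adj_armLink ..
  · exact fun x hx u huC ha => armLink_ne w _ _ _
  · intro x hx u huC ha x' hx' u' huC' ha' e
    have h : ∃ x ∈ pinwheel w m, squareLattice.Adj x u := ⟨x, hx, ha⟩
    have h' : ∃ x ∈ pinwheel w m, squareLattice.Adj x u' := ⟨x', hx', ha'⟩
    obtain ⟨e1, e2, e3⟩ := armLink_inj e
    have h1 := hne u h huC
    have h1' := hne u' h' huC'
    rw [hu u h, hu u' h', e1, e2]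
    congr 1
    -- Before the closed vertex k the link index is below k, beyond it at least k, so equal links
    -- force equal positions.
    simp only [d] at e3
    rw [← e1, ← e2] at h1' e3
    split_ifs at e3 <;> omega

end Trap

/-! ### Blocks -/

namespace Trap

/-- The index of the block (of side `2 * m`) containing `x`. -/
def block (m : ℕ) (x : ℤ × ℤ) : ℤ × ℤ := (x.1 / (2 * m), x.2 / (2 * m))

/-- The union of the `3 × 3` blocks around the block `b`. -/
noncomputable def blockRegion (m : ℕ) (b : ℤ × ℤ) : Finset (ℤ × ℤ) :=
  Finset.Ico (2 * m * (b.1 - 1)) (2 * m * (b.1 + 2)) ×ˢ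
    Finset.Ico (2 * m * (b.2 - 1)) (2 * m * (b.2 + 2))

/-- The block `b`, enlarged by one layer. -/
noncomputable def blockClosure (m : ℕ) (b : ℤ × ℤ) : Finset (ℤ × ℤ) :=
  Finset.Icc (2 * m * b.1 - 1) (2 * m * b.1 + 2 * m) ×ˢ
    Finset.Icc (2 * m * b.2 - 1) (2 * m * b.2 + 2 * m)

/-- A block is bad if some pinwheel centred at it might fail. -/
def BadBlock (C : Set (ℤ × ℤ)) (m : ℕ) (b : ℤ × ℤ) : Prop :=
  (m ≠ 1 ∧ ∃ x ∈ blockRegion m b, ¬ IsOddVertex x ∧ x ∈ C) ∨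
    ∃ w ∈ blockClosure m b, ¬ IsOddVertex w ∧ ∃ s, ∃ r < m, ∀ t < m, armVertex w s r t ∉ C

/-- The strict bound 2m exactly absorbs the extra layer of `blockClosure`. -/
theorem mem_blockRegion_of_abs_sub_lt {m : ℕ} {b w x : ℤ × ℤ} (hw : w ∈ blockClosure m b)
    (hx : |x.1 - w.1| < 2 * m ∧ |x.2 - w.2| < 2 * m) : x ∈ blockRegion m b := by
  simp only [blockClosure, blockRegion, Finset.mem_product, Finset.mem_Icc, Finset.mem_Ico,
    abs_lt, mul_sub, mul_add] at *
  omega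

theorem badBlock_of_mem_unsafeSet {C : Set (ℤ × ℤ)} {m : ℕ} (hm : m ≠ 0) {b w : ℤ × ℤ}
    (hw : w ∈ unsafeSet squareLattice C evenVertices) (hwe : w ∈ evenVertices)
    (hb : w ∈ blockClosure m b) : BadBlock C m b := by
  by_contra h
  simp only [BadBlock, not_or, not_and, not_exists, not_forall, not_not] at h
  refine hw.2.1 (mem_safeSet_of_pinwheel hm hwe (fun x hx hxC => ?_) fun s r hr => ?_)
  -- At size 1 the only even vertex is the centre, which is open because it is unsafe; no condition
  -- on closed even vertices is needed.
  · by_cases hm1 : m = 1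
    · subst hm1
      rw [pinwheel_one] at hx
      exact hw.1 (hx ▸ hxC)
    · exact h.1 hm1 x (mem_blockRegion_of_abs_sub_lt hb (abs_sub_lt_of_mem_pinwheel hx))
        (pinwheel_subset_evenVertices hwe m hx) hxC
  · simpa using h.2 w hb hwe s r hr

theorem block_bounds {m : ℕ} (hm : m ≠ 0) (x : ℤ × ℤ) :
    2 * m * (block m x).1 ≤ x.1 ∧ x.1 < 2 * m * (block m x).1 + 2 * m ∧
    2 * m * (block m x).2 ≤ x.2 ∧ x.2 < 2 * m * (block m x).2 + 2 * m := by
  have h : (0 : ℤ) < 2 * m := by positivity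
  have h1 := Int.mul_ediv_add_emod x.1 (2 * m)
  have h2 := Int.mul_ediv_add_emod x.2 (2 * m)
  have h3 := Int.emod_nonneg x.1 h.ne'
  have h4 := Int.emod_nonneg x.2 h.ne'
  have h5 := Int.emod_lt_of_pos x.1 h
  have h6 := Int.emod_lt_of_pos x.2 h
  simp only [block]
  refine ⟨?_, ?_, ?_, ?_⟩ <;> linarith

theorem abs_sub_le_one_of_adj {x y : ℤ × ℤ} (h : squareLattice.Adj x y) :
    |x.1 - y.1| ≤ 1 ∧ |x.2 - y.2| ≤ 1 := by
  rw [squareLattice_adj_iff] at h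
  simp only [abs_le]
  rcases h with rfl | rfl | rfl | rfl <;> simp

theorem mem_blockClosure_of_abs_sub_le {m : ℕ} (hm : m ≠ 0) {x y : ℤ × ℤ}
    (h : |x.1 - y.1| ≤ 1 ∧ |x.2 - y.2| ≤ 1) : y ∈ blockClosure m (block m x) := by
  have := block_bounds hm x
  simp only [blockClosure, Finset.mem_product, Finset.mem_Icc, abs_le] at *
  omega

theorem abs_block_sub_le {m : ℕ} (hm : m ≠ 0) {x y : ℤ × ℤ}
    (h : |x.1 - y.1| ≤ 1 ∧ |x.2 - y.2| ≤ 1) :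
    |(block m x).1 - (block m y).1| ≤ 1 ∧ |(block m x).2 - (block m y).2| ≤ 1 := by
  have hx := block_bounds hm x
  have hy := block_bounds hm y
  have h0 : (1 : ℤ) ≤ m := by omega
  simp only [abs_le] at *
  refine ⟨⟨?_, ?_⟩, ?_, ?_⟩ <;> by_contra! hc <;> nlinarith

/-- Every edge has an even end, which lies at most one layer outside the block of x; hence the
enlargement in `blockClosure`. -/
theorem badBlock_block_of_adj {C : Set (ℤ × ℤ)} {m : ℕ} (hm : m ≠ 0) {x y : ℤ × ℤ}
    (h : (unsafeGraph squareLattice C evenVertices).Adj x y) : BadBlock C m (block m x) := by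
  by_cases hx : x ∈ evenVertices
  · exact badBlock_of_mem_unsafeSet hm h.2.1 hx (mem_blockClosure_of_abs_sub_le hm (by simp))
  · have hy : y ∈ evenVertices := by
      by_contra hy
      exact hx ((mem_evenVertices_iff_of_adj _ _ h.1).2 hy)
    exact badBlock_of_mem_unsafeSet hm h.2.2 hy
      (mem_blockClosure_of_abs_sub_le hm (abs_sub_le_one_of_adj h.1))

/-! ### From infinite unsafe clusters to long paths of bad blocks -/

/-- The graph whose edges join neighbouring (possibly diagonally) bad blocks. -/
def badGraph (C : Set (ℤ × ℤ)) (m : ℕ) : SimpleGraph (ℤ × ℤ) where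
  Adj b b' := b ≠ b' ∧ (|b.1 - b'.1| ≤ 1 ∧ |b.2 - b'.2| ≤ 1) ∧ BadBlock C m b ∧ BadBlock C m b'
  symm := ⟨fun b b' h => ⟨h.1.symm, by rw [abs_sub_comm, abs_sub_comm b'.2]; exact h.2.1,
    h.2.2.2, h.2.2.1⟩⟩
  loopless := ⟨fun _ h => h.1 rfl⟩

theorem badGraph_reachable {C : Set (ℤ × ℤ)} {m : ℕ} (hm : m ≠ 0) {x y : ℤ × ℤ}
    (h : (unsafeGraph squareLattice C evenVertices).Reachable x y) :
    (badGraph C m).Reachable (block m x) (block m y) := by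
  obtain ⟨p⟩ := h
  induction p with
  | nil => exact SimpleGraph.Reachable.refl _
  | @cons u v w h _ ih =>
    refine SimpleGraph.Reachable.trans ?_ ih
    by_cases e : block m u = block m v
    · rw [e]
    · exact SimpleGraph.Adj.reachable ⟨e, abs_block_sub_le hm (abs_sub_le_one_of_adj h.1),
        badBlock_block_of_adj hm h, badBlock_block_of_adj hm h.symm⟩

theorem abs_sub_le_length {C : Set (ℤ × ℤ)} {m : ℕ} {b b' : ℤ × ℤ} (p : (badGraph C m).Walk b b') :
    |b.1 - b'.1| ≤ p.length ∧ |b.2 - b'.2| ≤ p.length := by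
  induction p with
  | nil => simp
  | cons h _ ih =>
    have h' := h.2.1
    simp only [abs_le, SimpleGraph.Walk.length_cons] at *
    omega

/-- The first `N` terms of `γ` form a self-avoiding path of neighbouring bad blocks from `b`. -/
structure IsBadPath (C : Set (ℤ × ℤ)) (m : ℕ) (b : ℤ × ℤ) (N : ℕ) (γ : ℕ → ℤ × ℤ) : Prop where
  zero : γ 0 = b
  step : ∀ i < N, |(γ (i + 1)).1 - (γ i).1| ≤ 1 ∧ |(γ (i + 1)).2 - (γ i).2| ≤ 1
  inj : ∀ i < N, ∀ j < N, γ i = γ j → i = j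
  bad : ∀ i < N, BadBlock C m (γ i)

theorem finite_preimage_block {m : ℕ} (hm : m ≠ 0) (b : ℤ × ℤ) (N : ℕ) :
    {x | |b.1 - (block m x).1| ≤ N ∧ |b.2 - (block m x).2| ≤ N}.Finite := by
  refine (((Finset.Icc (2 * m * (b.1 - N)) (2 * m * (b.1 + N + 1))) ×ˢ
    (Finset.Icc (2 * m * (b.2 - N)) (2 * m * (b.2 + N + 1))) : Finset (ℤ × ℤ)).finite_toSet).subset
    fun x hx => ?_
  have h := block_bounds hm x
  have h0 : (1 : ℤ) ≤ m := by omega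
  simp only [Set.mem_ofPred_eq, abs_le, Finset.coe_product, Set.mem_prod, Finset.coe_Icc,
    Set.mem_Icc] at *
  refine ⟨⟨?_, ?_⟩, ?_, ?_⟩ <;> nlinarith

/-- An infinite cluster leaves every finite box of blocks, and a path to a block at distance more
than N has more than N steps. -/
theorem exists_isBadPath {C : Set (ℤ × ℤ)} {m : ℕ} (hm : m ≠ 0) {v : ℤ × ℤ}
    (h : {a | (unsafeGraph squareLattice C evenVertices).Reachable v a}.Infinite) (N : ℕ) :
    ∃ γ, IsBadPath C m (block m v) N γ := by
  classical
  obtain ⟨a, ha, ha'⟩ := h.exists_notMem_finite (finite_preimage_block hm (block m v) N)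
  obtain ⟨p, hp⟩ := (badGraph_reachable hm ha).exists_isPath
  have hN : N < p.length := by
    by_contra! hN
    have := abs_sub_le_length p
    have hN' : (p.length : ℤ) ≤ N := by exact_mod_cast hN
    exact ha' ⟨this.1.trans hN', this.2.trans hN'⟩
  have hadj : ∀ i < N, (badGraph C m).Adj (p.getVert i) (p.getVert (i + 1)) := fun i hi =>
    p.adj_getVert_succ (hi.trans hN)
  refine ⟨p.getVert, p.getVert_zero, fun i hi => (hadj i hi).symm.2.1, fun i hi j hj e => ?_,
    fun i hi => (hadj i hi).2.2.1⟩
  exact hp.getVert_injOn (by simp; omega) (by simp; omega) e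

theorem not_isDraw_of_forall_exists_not_isBadPath {C : Set (ℤ × ℤ)} {m : ℕ} (hm : m ≠ 0)
    (h : ∀ b, ∃ N, ∀ γ, ¬ IsBadPath C m b N γ) (v : ℤ × ℤ) : ¬ IsDraw squareLattice C v := by
  refine not_isDraw_of_finite finite_neighborSet_squareLattice mem_evenVertices_iff_of_adj
    (fun v => ?_) v
  by_contra hinf
  obtain ⟨N, hN⟩ := h (block m v)
  obtain ⟨γ, hγ⟩ := exists_isBadPath hm hinf N
  exact hN γ hγ

end Trap

/-! ### Independence of distant blocks -/

open MeasureTheory ProbabilityTheory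

/-- There are only finitely many configurations on S, so measurability is automatic. -/
theorem exists_measurableSet_eq_restrict_preimage {ι : Type*} (S : Finset ι) {E : Set (ι → Prop)}
    (hE : ∀ ω ω' : ι → Prop, (∀ i ∈ S, ω i = ω' i) → ω ∈ E → ω' ∈ E) :
    ∃ E' : Set (S → Prop), MeasurableSet E' ∧ E = S.restrict ⁻¹' E' := by
  refine ⟨S.restrict '' E, (Set.toFinite _).measurableSet, ?_⟩
  refine (Set.subset_preimage_image _ _).antisymm ?_
  rintro ω ⟨ω', hω', h⟩
  exact hE ω' ω (fun i hi => congrFun h ⟨i, hi⟩) hω'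

theorem infinitePi_inter_of_disjoint {ι : Type*} (μ : ι → Measure Prop)
    [∀ i, IsProbabilityMeasure (μ i)] {S S' : Finset ι} (hS : Disjoint S S')
    {E E' : Set (ι → Prop)}
    (hE : ∀ ω ω' : ι → Prop, (∀ i ∈ S, ω i = ω' i) → ω ∈ E → ω' ∈ E)
    (hE' : ∀ ω ω' : ι → Prop, (∀ i ∈ S', ω i = ω' i) → ω ∈ E' → ω' ∈ E') :
    Measure.infinitePi μ (E ∩ E') = Measure.infinitePi μ E * Measure.infinitePi μ E' := by
  obtain ⟨F, hF, rfl⟩ := exists_measurableSet_eq_restrict_preimage S hE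
  obtain ⟨F', hF', rfl⟩ := exists_measurableSet_eq_restrict_preimage S' hE'
  have h := (iIndepFun_infinitePi (P := μ) (X := fun _ => id)
    (fun _ => measurable_id)).indepFun_finset S S' hS (fun i => measurable_pi_apply i)
  exact h.measure_inter_preimage_eq_mul F F' hF hF'

theorem infinitePi_biInter_le_pow {ι κ : Type*} [DecidableEq ι] [DecidableEq κ]
    (μ : ι → Measure Prop)
    [∀ i, IsProbabilityMeasure (μ i)] (S : κ → Finset ι) (E : κ → Set (ι → Prop))
    (hE : ∀ k, ∀ ω ω' : ι → Prop, (∀ i ∈ S k, ω i = ω' i) → ω ∈ E k → ω' ∈ E k)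
    {ε : ENNReal} (hε : ∀ k, Measure.infinitePi μ (E k) ≤ ε) (I : Finset κ)
    (hI : (I : Set κ).PairwiseDisjoint S) :
    Measure.infinitePi μ (⋂ k ∈ I, E k) ≤ ε ^ I.card := by
  induction I using Finset.induction_on with
  | empty => simp
  | insert a I ha ih =>
    rw [Finset.set_biInter_insert, Finset.card_insert_of_notMem ha, pow_succ']
    rw [infinitePi_inter_of_disjoint μ (S := S a) (S' := I.biUnion S) _ (hE a)]
    · exact mul_le_mul' (hε a) (ih (hI.subset (by simp)))
    · intro ω ω' h hω
      simp only [Set.mem_iInter, Finset.mem_biUnion] at *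
      exact fun k hk => hE k ω ω' (fun i hi => h i ⟨k, hk, hi⟩) (hω k hk)
    · rw [Finset.disjoint_biUnion_right]
      exact fun k hk => hI (by simp) (by simp [hk]) (fun e => ha (e ▸ hk))

namespace Trap

theorem badBlock_of_agree {m : ℕ} {b : ℤ × ℤ} {ω ω' : ℤ × ℤ → Prop}
    (h : ∀ x ∈ blockRegion m b, ω x = ω' x) (hω : BadBlock {u | ω u} m b) :
    BadBlock {u | ω' u} m b := by
  rcases hω with ⟨hm, x, hx, hxo, hxC⟩ | ⟨w, hw, hwo, s, r, hr, hC⟩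
  · exact Or.inl ⟨hm, x, hx, hxo, by simpa [← h x hx] using hxC⟩
  · refine Or.inr ⟨w, hw, hwo, s, r, hr, fun t ht => ?_⟩
    have := h _ (mem_blockRegion_of_abs_sub_lt hw (abs_armVertex_sub_le w s hr ht))
    simpa [← this] using hC t ht

theorem disjoint_blockRegion {m : ℕ} {b b' : ℤ × ℤ}
    (h1 : (3 : ℤ) ∣ b.1 - b'.1) (h2 : (3 : ℤ) ∣ b.2 - b'.2) (hne : b ≠ b') :
    Disjoint (blockRegion m b) (blockRegion m b') := by
  rw [Finset.disjoint_left]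
  intro x hx hx'
  simp only [blockRegion, Finset.mem_product, Finset.mem_Ico] at hx hx'
  have h0 : (0 : ℤ) ≤ m := by positivity
  have hor : b.1 + 3 ≤ b'.1 ∨ b'.1 + 3 ≤ b.1 ∨ b.2 + 3 ≤ b'.2 ∨ b'.2 + 3 ≤ b.2 := by
    by_contra! hc
    exact hne (Prod.ext (by omega) (by omega))
  rcases hor with h | h | h | h <;> nlinarith

/-- Among `9 * k` blocks, `k` have disjoint regions. -/
theorem exists_pairwiseDisjoint_blockRegion (m : ℕ) {k : ℕ} {J : Finset (ℤ × ℤ)}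
    (hJ : J.card = 9 * k) :
    ∃ I ⊆ J, k ≤ I.card ∧ (I : Set (ℤ × ℤ)).PairwiseDisjoint (blockRegion m) := by
  classical
  -- Pigeonhole over the nine residue classes modulo 3: distinct blocks in one class have disjoint 3
  -- × 3 neighbourhoods.
  let f : ℤ × ℤ → ZMod 3 × ZMod 3 := fun b => (b.1, b.2)
  obtain ⟨y, -, hy⟩ := Finset.exists_le_card_fiber_of_mul_le_card_of_maps_to (s := J)
    (t := Finset.univ) (f := f) (n := k) (fun _ _ => Finset.mem_univ _) Finset.univ_nonempty
    (by rw [hJ]; simp [ZMod.card])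
  refine ⟨_, Finset.filter_subset _ _, hy, fun b hb b' hb' hne => ?_⟩
  have h : f b = f b' := (Finset.mem_filter.1 hb).2.trans (Finset.mem_filter.1 hb').2.symm
  have h1 := congrArg Prod.fst h
  have h2 := congrArg Prod.snd h
  simp only [f] at h1 h2
  refine disjoint_blockRegion ?_ ?_ hne
  · exact (ZMod.intCast_eq_intCast_iff_dvd_sub _ _ 3).1 h1.symm
  · exact (ZMod.intCast_eq_intCast_iff_dvd_sub _ _ 3).1 h2.symm

instance (p q : unitInterval) : IsProbabilityMeasure (closedLaw p q) := by
  unfold closedLaw; infer_instance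

theorem closedLaw_forall_badBlock_le {p q : unitInterval} {m : ℕ} {ε : ENNReal} (hε1 : ε ≤ 1)
    (hε : ∀ b, closedLaw p q {ω | BadBlock {u | ω u} m b} ≤ ε) {k : ℕ} {J : Finset (ℤ × ℤ)}
    (hJ : J.card = 9 * k) :
    closedLaw p q {ω | ∀ b ∈ J, BadBlock {u | ω u} m b} ≤ ε ^ k := by
  classical
  obtain ⟨I, hIJ, hIk, hI⟩ := exists_pairwiseDisjoint_blockRegion m hJ
  calc _ ≤ closedLaw p q (⋂ b ∈ I, {ω | BadBlock {u | ω u} m b}) :=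
        measure_mono fun ω hω => by
          simp only [Set.mem_iInter]
          exact fun b hb => hω b (hIJ hb)
    _ ≤ ε ^ I.card := infinitePi_biInter_le_pow _ (blockRegion m) _
        (fun b ω ω' h hω => badBlock_of_agree h hω) hε I hI
    _ ≤ ε ^ k := pow_le_pow_right_of_le_one' hε1 hIk

/-! ### Peierls argument -/

/-- The path from `b` with the given steps. -/
def pathOfSteps {N : ℕ} (b : ℤ × ℤ) (d : Fin N → ℤ × ℤ) (i : ℕ) : ℤ × ℤ :=
  b + ∑ j ∈ Finset.range i, if h : j < N then d ⟨j, h⟩ else 0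

theorem IsBadPath.exists_steps {C : Set (ℤ × ℤ)} {m N : ℕ} {b : ℤ × ℤ} {γ : ℕ → ℤ × ℤ}
    (h : IsBadPath C m b N γ) :
    ∃ d ∈ Fintype.piFinset fun _ : Fin N => Finset.Icc (-1 : ℤ) 1 ×ˢ Finset.Icc (-1 : ℤ) 1,
      ∀ i < N, pathOfSteps b d i = γ i := by
  refine ⟨fun j => γ (j + 1) - γ j, ?_, fun i hi => ?_⟩
  · simp only [Fintype.mem_piFinset, Finset.mem_product, Finset.mem_Icc]
    intro j
    have := h.step j j.2
    simpa only [abs_le, Prod.fst_sub, Prod.snd_sub] using this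
  · have : ∀ j ∈ Finset.range i, (if h : j < N then γ (j + 1) - γ j else 0) =
        γ (j + 1) - γ j := fun j hj => dif_pos ((Finset.mem_range.1 hj).trans hi)
    rw [pathOfSteps, Finset.sum_congr rfl this, Finset.sum_range_sub, h.zero]
    abel

/-- Union bound: 9 choices for each of 9k steps, and each self-avoiding path contains k independent
bad blocks. -/
theorem closedLaw_exists_isBadPath_le {p q : unitInterval} {m : ℕ} {ε : ENNReal} (hε1 : ε ≤ 1)
    (hε : ∀ b, closedLaw p q {ω | BadBlock {u | ω u} m b} ≤ ε) (k : ℕ) (b : ℤ × ℤ) :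
    closedLaw p q {ω | ∃ γ, IsBadPath {u | ω u} m b (9 * k) γ} ≤ (9 ^ 9 * ε) ^ k := by
  classical
  set D := Fintype.piFinset fun _ : Fin (9 * k) => Finset.Icc (-1 : ℤ) 1 ×ˢ Finset.Icc (-1 : ℤ) 1
    with hD
  have hcard : D.card = 9 ^ (9 * k) := by simp [hD]
  set E : (Fin (9 * k) → ℤ × ℤ) → Set (ℤ × ℤ → Prop) := fun d =>
    {ω | (∀ i < 9 * k, ∀ j < 9 * k, pathOfSteps b d i = pathOfSteps b d j → i = j) ∧
      ∀ i < 9 * k, BadBlock {u | ω u} m (pathOfSteps b d i)} with hE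
  have hEle : ∀ d, closedLaw p q (E d) ≤ ε ^ k := fun d => by
    by_cases hinj : ∀ i < 9 * k, ∀ j < 9 * k, pathOfSteps b d i = pathOfSteps b d j → i = j
    · refine (measure_mono ?_).trans (closedLaw_forall_badBlock_le hε1 hε
        (J := (Finset.range (9 * k)).image (pathOfSteps b d)) ?_)
      · intro ω hω b' hb'
        obtain ⟨i, hi, rfl⟩ := Finset.mem_image.1 hb'
        exact hω.2 i (Finset.mem_range.1 hi)
      · rw [Finset.card_image_of_injOn, Finset.card_range]
        exact fun i hi j hj e => hinj i (by simpa using hi) j (by simpa using hj) e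
    · have : E d = ∅ := Set.eq_empty_of_forall_notMem fun ω hω => hinj hω.1
      simp [this]
  calc _ ≤ closedLaw p q (⋃ d ∈ D, E d) := measure_mono <| by
        rintro ω ⟨γ, hγ⟩
        obtain ⟨d, hd, h⟩ := hγ.exists_steps
        simp only [Set.mem_iUnion]
        refine ⟨d, hd, fun i hi j hj e => hγ.inj i hi j hj ?_, fun i hi => ?_⟩
        · rwa [← h i hi, ← h j hj]
        · rw [h i hi]; exact hγ.bad i hi
    _ ≤ ∑ d ∈ D, closedLaw p q (E d) := measure_biUnion_finset_le _ _
    _ ≤ ∑ d ∈ D, ε ^ k := Finset.sum_le_sum fun d _ => hEle d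
    _ = (9 ^ 9 * ε) ^ k := by
        rw [Finset.sum_const, hcard, nsmul_eq_mul, mul_pow, ← pow_mul]; push_cast; rfl

/-- If blocks are bad with small probability, then there are almost surely no draws. -/
theorem ae_not_isDraw_of_badBlock_le {p q : unitInterval} {m : ℕ} (hm : m ≠ 0) {ε : ENNReal}
    (hε1 : 9 ^ 9 * ε < 1)
    (hε : ∀ b, closedLaw p q {ω | BadBlock {u | ω u} m b} ≤ ε) :
    ∀ᵐ ω ∂(closedLaw p q), ∀ v : ℤ × ℤ, ¬ IsDraw squareLattice {u | ω u} v := by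
  have hε' : ε ≤ 1 := le_trans (le_mul_of_one_le_left zero_le (one_le_pow₀ (by norm_num))) hε1.le
  have h : ∀ᵐ ω ∂(closedLaw p q), ∀ b, ∃ N, ∀ γ, ¬ IsBadPath {u | ω u} m b N γ := by
    rw [ae_all_iff]
    intro b
    rw [ae_iff]
    -- Bad paths of every length 9k would have to exist, and their probability tends to 0 with k.
    refine le_antisymm (ge_of_tendsto' (ENNReal.tendsto_pow_atTop_nhds_zero_of_lt_one hε1)
      fun k => ?_) zero_le
    refine (measure_mono fun ω hω => ?_).trans (closedLaw_exists_isBadPath_le hε' hε k b)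
    have hω' : ¬ ∃ N, ∀ γ, ¬ IsBadPath {u | ω u} m b N γ := hω
    push Not at hω'
    exact hω' (9 * k)
  filter_upwards [h] with ω hω using not_isDraw_of_forall_exists_not_isBadPath hm hω

end Trap

/-! ### Estimates -/

namespace Trap

theorem closedLaw_closed {p q : unitInterval} {x : ℤ × ℤ} (hx : ¬ IsOddVertex x) :
    closedLaw p q {ω | ω x} = ENNReal.ofReal q := by
  classical
  have h := Measure.infinitePi_pi (s := {x}) (t := fun _ => {True})
    (μ := fun u => bernoulliMeasure True False (if IsOddVertex u then p else q))
    (fun _ _ => MeasurableSet.of_discrete)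
  have e : Set.pi (({x} : Finset (ℤ × ℤ)) : Set (ℤ × ℤ)) (fun _ => {True}) = {ω | ω x} := by
    ext ω; simp
  rw [e] at h
  refine h.trans ?_
  rw [Finset.prod_singleton, bernoulliMeasure_apply _ MeasurableSet.of_discrete]
  simp [hx, ENNReal.ofReal, Real.toNNReal_of_nonneg q.2.1, unitInterval.toNNReal]
  rfl

theorem closedLaw_open {p q : unitInterval} (A : Finset (ℤ × ℤ)) (hA : ∀ x ∈ A, IsOddVertex x) :
    closedLaw p q {ω | ∀ x ∈ A, ¬ ω x} = ENNReal.ofReal ((1 - p) ^ A.card) := by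
  classical
  have h := Measure.infinitePi_pi (s := A) (t := fun _ => {False})
    (μ := fun u => bernoulliMeasure True False (if IsOddVertex u then p else q))
    (fun _ _ => MeasurableSet.of_discrete)
  have e : Set.pi (A : Set (ℤ × ℤ)) (fun _ => {False}) = {ω | ∀ x ∈ A, ¬ ω x} := by
    ext ω; simp [Set.mem_pi]
  rw [e] at h
  refine h.trans ?_
  rw [ENNReal.ofReal_pow (by linarith [p.2.2]), ← Finset.prod_const]
  refine Finset.prod_congr rfl fun x hx => ?_
  rw [bernoulliMeasure_apply _ MeasurableSet.of_discrete]
  simp [hA x hx, ENNReal.ofReal, unitInterval.toNNReal]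
  rw [Real.toNNReal_of_nonneg (by linarith [p.2.2])]
  rfl

theorem closedLaw_arm_open {p q : unitInterval} {w : ℤ × ℤ} (hw : ¬ IsOddVertex w) (s : Fin 4)
    (r m : ℕ) :
    closedLaw p q {ω | ∀ t < m, ¬ ω (armVertex w s r t)} = ENNReal.ofReal ((1 - p) ^ m) := by
  classical
  have h := closedLaw_open (p := p) (q := q) ((Finset.range m).image (armVertex w s r))
    (by simp only [Finset.mem_image]; rintro _ ⟨t, -, rfl⟩; exact isOddVertex_armVertex hw s r t)
  rw [Finset.card_image_of_injective _ fun t t' e => (armVertex_inj e).2, Finset.card_range] at h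
  simpa using h

theorem closedLaw_exists_closed_le {p q : unitInterval} (A : Finset (ℤ × ℤ)) :
    closedLaw p q {ω | ∃ x ∈ A, ¬ IsOddVertex x ∧ ω x} ≤ A.card * ENNReal.ofReal q := by
  classical
  calc _ ≤ closedLaw p q (⋃ x ∈ A.filter (¬ IsOddVertex ·), {ω | ω x}) := measure_mono <| by
        rintro ω ⟨x, hx, hxo, h⟩
        simp only [Set.mem_iUnion]
        exact ⟨x, Finset.mem_filter.2 ⟨hx, hxo⟩, h⟩
    _ ≤ ∑ x ∈ A.filter (¬ IsOddVertex ·), closedLaw p q {ω | ω x} :=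
        measure_biUnion_finset_le _ _
    _ = (A.filter (¬ IsOddVertex ·)).card * ENNReal.ofReal q := by
        rw [Finset.sum_congr rfl fun x hx => closedLaw_closed (Finset.mem_filter.1 hx).2]
        simp
    _ ≤ _ := by gcongr; exact Finset.filter_subset _ _

theorem closedLaw_exists_arm_open_le {p q : unitInterval} (A : Finset (ℤ × ℤ)) (m : ℕ) :
    closedLaw p q {ω | ∃ w ∈ A, ¬ IsOddVertex w ∧
      ∃ s, ∃ r < m, ∀ t < m, ¬ ω (armVertex w s r t)} ≤
      (A.card * (4 * m) : ℕ) * ENNReal.ofReal ((1 - p) ^ m) := by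
  classical
  set B := A.filter (¬ IsOddVertex ·) ×ˢ ((Finset.univ : Finset (Fin 4)) ×ˢ Finset.range m)
  calc _ ≤ closedLaw p q (⋃ z ∈ B, {ω | ∀ t < m, ¬ ω (armVertex z.1 z.2.1 z.2.2 t)}) :=
      measure_mono <| by
        rintro ω ⟨x, hx, hxo, s, r, hr, h⟩
        simp only [Set.mem_iUnion]
        exact ⟨(x, s, r), by simp [B, hx, hxo, hr], h⟩
    _ ≤ ∑ z ∈ B, closedLaw p q {ω | ∀ t < m, ¬ ω (armVertex z.1 z.2.1 z.2.2 t)} :=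
        measure_biUnion_finset_le _ _
    _ = B.card * ENNReal.ofReal ((1 - p) ^ m) := by
        rw [Finset.sum_congr rfl fun z hz => closedLaw_arm_open (by
          simp only [B, Finset.mem_product, Finset.mem_filter] at hz; exact hz.1.2) _ _ _]
        simp
    _ ≤ _ := by
        gcongr
        simp only [B, Finset.card_product, Finset.card_univ, Fintype.card_fin, Finset.card_range]
        gcongr
        exact Finset.filter_subset _ _

theorem card_blockRegion (m : ℕ) (b : ℤ × ℤ) : (blockRegion m b).card = 36 * m ^ 2 := by
  have h (a : ℤ) : (2 * m * (a + 2) - 2 * m * (a - 1)).toNat = 6 * m := by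
    rw [show 2 * m * (a + 2) - 2 * m * (a - 1) = ((6 * m : ℕ) : ℤ) by push_cast; ring]
    exact Int.toNat_natCast _
  rw [blockRegion, Finset.card_product, Int.card_Ico, Int.card_Ico, h, h]
  ring

theorem card_blockClosure_le {m : ℕ} (hm : m ≠ 0) (b : ℤ × ℤ) :
    (blockClosure m b).card ≤ 16 * m ^ 2 := by
  have h (a : ℤ) : (2 * m * a + 2 * m + 1 - (2 * m * a - 1)).toNat = 2 * m + 2 := by
    rw [show 2 * m * a + 2 * m + 1 - (2 * m * a - 1) = ((2 * m + 2 : ℕ) : ℤ) by push_cast; ring]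
    exact Int.toNat_natCast _
  rw [blockClosure, Finset.card_product, Int.card_Icc, Int.card_Icc, h, h]
  have : 1 ≤ m := Nat.one_le_iff_ne_zero.2 hm
  nlinarith

theorem closedLaw_badBlock_le {p q : unitInterval} {m : ℕ} (hm : m ≠ 0) (b : ℤ × ℤ) :
    closedLaw p q {ω | BadBlock {u | ω u} m b} ≤
      ENNReal.ofReal ((if m = 1 then 0 else 36 * (m : ℝ) ^ 2 * q) + 64 * (m : ℝ) ^ 3 * (1 - p) ^ m) := by
  have hp : (0 : ℝ) ≤ 1 - p := by linarith [p.2.2]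
  have hq : (0 : ℝ) ≤ q := q.2.1
  have h2 : closedLaw p q {ω | ∃ w ∈ blockClosure m b, ¬ IsOddVertex w ∧
      ∃ s, ∃ r < m, ∀ t < m, ¬ ω (armVertex w s r t)} ≤
      ENNReal.ofReal (64 * m ^ 3 * (1 - p) ^ m) := by
    refine (closedLaw_exists_arm_open_le _ _).trans ?_
    rw [ENNReal.ofReal_mul (by positivity)]
    gcongr
    rw [← ENNReal.ofReal_natCast]
    refine ENNReal.ofReal_le_ofReal ?_
    have := Nat.mul_le_mul_right (4 * m) (card_blockClosure_le hm b)
    calc (((blockClosure m b).card * (4 * m) : ℕ) : ℝ) ≤ (16 * m ^ 2 * (4 * m) : ℕ) := by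
          exact_mod_cast this
      _ = 64 * m ^ 3 := by push_cast; ring
  by_cases hm1 : m = 1
  · refine le_trans (measure_mono ?_) (h2.trans (by simp [hm1]))
    rintro ω (h | h)
    · exact absurd hm1 h.1
    · exact h
  · rw [if_neg hm1, ENNReal.ofReal_add (by positivity) (by positivity)]
    refine (measure_mono (t := {ω | ∃ x ∈ blockRegion m b, ¬ IsOddVertex x ∧ ω x} ∪ _) ?_).trans
      ((measure_union_le _ _).trans (add_le_add ((closedLaw_exists_closed_le _).trans ?_) h2))
    · rintro ω (h | h)
      · exact Or.inl h.2
      · exact Or.inr h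
    · rw [card_blockRegion, ENNReal.ofReal_mul (by positivity), ← ENNReal.ofReal_natCast]
      push_cast
      rfl

theorem ae_not_isDraw_of_estimate {p q : unitInterval} {m : ℕ} (hm : m ≠ 0)
    (h : (if m = 1 then 0 else 36 * (m : ℝ) ^ 2 * q) + 64 * (m : ℝ) ^ 3 * (1 - p) ^ m ≤
      1 / 10 ^ 9) :
    ∀ᵐ ω ∂(closedLaw p q), ∀ v : ℤ × ℤ, ¬ IsDraw squareLattice {u | ω u} v := by
  -- The value 1 / 10 ^ 9 suffices since 9^9 < 10^9.
  refine ae_not_isDraw_of_badBlock_le hm (ε := ENNReal.ofReal (1 / 10 ^ 9)) ?_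
    fun b => (closedLaw_badBlock_le hm b).trans (ENNReal.ofReal_le_ofReal h)
  rw [show (9 : ENNReal) ^ 9 = ENNReal.ofReal (9 ^ 9) by
    rw [ENNReal.ofReal_pow (by norm_num)]; norm_num, ← ENNReal.ofReal_mul (by positivity),
    ENNReal.ofReal_lt_one]
  norm_num

/-- Choice of the scale when odd vertices are seldom closed. -/
theorem exists_scale_of_le_half {p q : ℝ} (hp : 0 < p) (hp2 : p ≤ 1 / 2) (hq : 0 ≤ q)
    (h : q * Real.log p⁻¹ ^ 2 < 1 / 10 ^ 40 * p ^ 2) :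
    ∃ m : ℕ, m ≠ 0 ∧ m ≠ 1 ∧
      36 * (m : ℝ) ^ 2 * q + 64 * (m : ℝ) ^ 3 * (1 - p) ^ m ≤ 1 / 10 ^ 9 := by
  set l := Real.log p⁻¹ with hl
  have hl1 : 1 / 2 ≤ l := by
    have h1 : Real.log 2 ≤ l := Real.log_le_log (by norm_num) (by
      rw [le_inv_comm₀ (by norm_num) hp]; linarith)
    linarith [Real.log_two_gt_d9]
  have hlp : l ≤ 1 / p := by
    have := Real.log_le_sub_one_of_pos (inv_pos.2 hp)
    rw [one_div]; linarith
  have hx1 : 1 ≤ l / p := by rw [le_div_iff₀ hp]; linarith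
  -- The factor 100 gives (1-p)^m ≤ p^100, of which m^3 ≤ (101/p^2)^3 consumes only p^6.
  set m := ⌈100 * (l / p)⌉₊ with hm
  have hm1 : 100 * (l / p) ≤ m := Nat.le_ceil _
  have hm2 : (m : ℝ) ≤ 101 * (l / p) := by
    have := Nat.ceil_lt_add_one (a := 100 * (l / p)) (by linarith)
    linarith
  have hm100 : (100 : ℝ) ≤ m := by linarith
  refine ⟨m, ?_, ?_, ?_⟩
  · rintro h0; rw [h0] at hm100; norm_num at hm100
  · rintro h0; rw [h0] at hm100; norm_num at hm100
  have e1 : (m : ℝ) ^ 2 * q ≤ 101 ^ 2 / 10 ^ 40 := by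
    have h3 : (m : ℝ) ^ 2 ≤ (101 * (l / p)) ^ 2 := by gcongr
    calc (m : ℝ) ^ 2 * q ≤ (101 * (l / p)) ^ 2 * q := by gcongr
      _ = 101 ^ 2 * ((q * l ^ 2) / p ^ 2) := by field_simp
      _ ≤ 101 ^ 2 * (1 / 10 ^ 40) := by
        refine mul_le_mul_of_nonneg_left ?_ (by norm_num)
        rw [div_le_iff₀ (by positivity)]
        exact h.le
      _ = _ := by ring
  have e2 : (1 - p) ^ m ≤ p ^ 100 := by
    have h4 : 1 - p ≤ Real.exp (-p) := by linarith [Real.add_one_le_exp (-p)]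
    calc (1 - p) ^ m ≤ Real.exp (-p) ^ m := pow_le_pow_left₀ (by linarith) h4 _
      _ = Real.exp (-(p * m)) := by rw [← Real.exp_nat_mul]; ring_nf
      _ ≤ Real.exp (-(100 * l)) := by
        refine Real.exp_le_exp.2 (neg_le_neg ?_)
        calc 100 * l = p * (100 * (l / p)) := by field_simp
          _ ≤ p * m := by gcongr
      _ = p ^ 100 := by
        rw [hl, Real.log_inv, mul_neg, neg_neg, mul_comm, Real.exp_mul, Real.exp_log hp]
        norm_cast
  have e3 : (m : ℝ) ^ 3 * (1 - p) ^ m ≤ 101 ^ 3 * (1 / 2) ^ 94 := by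
    have h5 : (m : ℝ) ≤ 101 / p ^ 2 := hm2.trans (by
      calc 101 * (l / p) ≤ 101 * ((1 / p) / p) := by gcongr
        _ = 101 / p ^ 2 := by field_simp)
    have h6 : (0 : ℝ) ≤ (1 - p) ^ m := pow_nonneg (by linarith) _
    calc (m : ℝ) ^ 3 * (1 - p) ^ m ≤ (101 / p ^ 2) ^ 3 * p ^ 100 := by gcongr
      _ = 101 ^ 3 * p ^ 94 := by field_simp
      _ ≤ _ := by gcongr
  calc 36 * (m : ℝ) ^ 2 * q + 64 * (m : ℝ) ^ 3 * (1 - p) ^ m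
      = 36 * ((m : ℝ) ^ 2 * q) + 64 * ((m : ℝ) ^ 3 * (1 - p) ^ m) := by ring
    _ ≤ 36 * (101 ^ 2 / 10 ^ 40) + 64 * (101 ^ 3 * (1 / 2) ^ 94) := by gcongr
    _ ≤ _ := by norm_num

end Trap

theorem mainTheorem8 :
    ∃ c₀ : ℝ, 0 < c₀ ∧ ∀ p q : unitInterval, 0 < (p : ℝ) →
      -- `q < c₀ p² log⁻² p⁻¹`, with the right-hand side read as `+∞` when `p = 1`
      (q : ℝ) * Real.log (p : ℝ)⁻¹ ^ 2 < c₀ * (p : ℝ) ^ 2 →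
      ∀ᵐ ω ∂(closedLaw p q), ∀ v : ℤ × ℤ, ¬ Trap.IsDraw squareLattice {u | ω u} v := by
  refine ⟨1 / 10 ^ 40, by norm_num, fun p q hp h => ?_⟩
  have hq : (0 : ℝ) ≤ q := q.2.1
  have hp1 : (p : ℝ) ≤ 1 := p.2.2
  rcases le_or_gt (p : ℝ) (1 / 2) with hp2 | hp2
  · obtain ⟨m, hm0, hm1, hm⟩ := Trap.exists_scale_of_le_half hp hp2 hq h
    exact Trap.ae_not_isDraw_of_estimate hm0 (by rwa [if_neg hm1])
  -- For p bounded away from 0 and 1 a fixed scale works, since log(1/p) ≥ 10^(-11) still forces q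
  -- to be small. As p approaches 1 the bound on q disappears, and scale 1, which ignores closed
  -- even vertices, takes over: 64(1-p) is then below 10^(-9).
  rcases le_or_gt (p : ℝ) (1 - 1 / 10 ^ 11) with hp3 | hp3
  · refine Trap.ae_not_isDraw_of_estimate (m := 100) (by norm_num) ?_
    have hl : 1 / 10 ^ 11 ≤ Real.log (p : ℝ)⁻¹ := by
      rw [Real.log_inv]
      linarith [Real.log_le_sub_one_of_pos hp]
    have hq' : (q : ℝ) ≤ 1 / 10 ^ 18 := by
      have h1 : (q : ℝ) * (1 / 10 ^ 11) ^ 2 ≤ 1 / 10 ^ 40 * 1 ^ 2 := by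
        refine le_trans ?_ (h.le.trans ?_) <;> gcongr
      linarith
    have h2 : (1 - p : ℝ) ^ 100 ≤ (1 / 2) ^ 100 := pow_le_pow_left₀ (by linarith) (by linarith) _
    rw [if_neg (by norm_num)]
    push_cast
    linarith
  · refine Trap.ae_not_isDraw_of_estimate (m := 1) (by norm_num) ?_
    rw [if_pos rfl]
    push_cast
    linarith
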